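/- In this statement a \emph{polyhedron} is a nonempty subset of $\mathbb{R}^3$ that is a union of finitely many nondegenerate tetrahedra (it need be neither convex nor connected). A \emph{decomposition} of a set $P\subset\mathbb{R}^3$ is a finite family of sets whose union is $P$ and whose interiors are pairwise disjoint. A polyhedron $P$ \emph{can be inside-out dissected} if it has a decomposition into polyhedra $P_1,\dots,P_k$ with connected interiors, and there are orientation-preserving isometries (compositions of rotations and translations) $g_1,\dots,g_k$ of $\mathbb{R}^3$, such that (1) $g_1(P_1),\dots,g_k(P_k)$ form a decomposition of a set $P'$ that is congruent to $P$ (that is, $P'$ is the image of $P$ under an isometry of $\mathbb{R}^3$); (2) the boundary of $P'$ is composed of internal cuts of $P$, that is, $$\partial P'\subseteq\bigcup_{i=1}^{k} g_i\bigl(\overline{\partial P_i\cap \operatorname{int}P}\bigr).$$ Theorem. Every polyhedron that can be decomposed into finitely many regular tetrahedra and regular octahedra (of arbitrary sizes and positions) can be inside-out dissected. -/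

import Mathlib

/-- Euclidean three-dimensional space. -/
abbrev Space : Type := EuclideanSpace ℝ (Fin 3)

/-- A (solid) polyhedron: a nonempty union of finitely many nondegenerate tetrahedra.
No convexity, connectedness or genus restriction is imposed. -/
def IsPolyhedron (P : Set Space) : Prop :=
  ∃ (n : ℕ) (v : Fin (n + 1) → Fin 4 → Space),
    (∀ i, AffineIndependent ℝ (v i)) ∧ P = ⋃ i, convexHull ℝ (Set.range (v i))

/-- A regular tetrahedron of any size: the convex hull of four points whose mutual distances
all have the same positive value. -/
def IsRegularTetrahedron (T : Set Space) : Prop :=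
  ∃ (v : Fin 4 → Space) (a : ℝ), 0 < a ∧ (∀ i j, i ≠ j → dist (v i) (v j) = a) ∧
    T = convexHull ℝ (Set.range v)

/-- A regular octahedron of any size: the convex hull of the six points `c ± r • b i`, where
`c` is the centre, `r > 0` the circumradius and `b` an orthonormal basis. -/
def IsRegularOctahedron (O : Set Space) : Prop :=
  ∃ (c : Space) (r : ℝ) (b : OrthonormalBasis (Fin 3) ℝ Space), 0 < r ∧
    O = convexHull ℝ (Set.range (fun i => c + r • b i) ∪ Set.range (fun i => c - r • b i))

/-- `Q` decomposes `P`: the sets `Q i` fill `P` and do not overlap. -/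
def IsDecomposition {ι : Type*} (P : Set Space) (Q : ι → Set Space) : Prop :=
  (⋃ i, Q i) = P ∧ Pairwise fun i j => Disjoint (interior (Q i)) (interior (Q j))

/-- A proper rigid motion, i.e. a composition of rotations and translations (no reflections). -/
def IsProperMotion (g : Space ≃ᵃⁱ[ℝ] Space) : Prop :=
  LinearMap.det (g.linearIsometryEquiv.toLinearEquiv : Space →ₗ[ℝ] Space) = 1

/-- Congruence of subsets of space. -/
def AreCongruent (P P' : Set Space) : Prop :=
  ∃ h : Space ≃ᵃⁱ[ℝ] Space, P' = h '' P

/-- The internal cuts of `P` along the surface of a piece `Q`: the part of the surface of `Q`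
that runs through the interior of `P`, together with its limit points (the rim of the cut). -/
def internalCuts (P Q : Set Space) : Set Space :=
  closure (frontier Q ∩ interior P)

/-- `P` can be inside-out dissected: it decomposes into finitely many polyhedra (each with
connected interior, so that a piece is a single body) that can be moved by rotations and
translations so as to form, without overlap, a set `P'` congruent to `P`, in such a way that
every point of the boundary of `P'` comes from an internal cut of `P`. -/
def InsideOutDissectable (P : Set Space) : Prop :=
  ∃ (k : ℕ) (Q : Fin k → Set Space) (g : Fin k → Space ≃ᵃⁱ[ℝ] Space) (P' : Set Space),
    (∀ i, IsPolyhedron (Q i) ∧ IsConnected (interior (Q i))) ∧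
    IsDecomposition P Q ∧
    (∀ i, IsProperMotion (g i)) ∧
    IsDecomposition P' (fun i => g i '' Q i) ∧
    AreCongruent P P' ∧
    frontier P' ⊆ ⋃ i, g i '' internalCuts P (Q i)

/-! Four affine coordinates `lam`, of sum 4, are adapted to the face normals of a regular
tetrahedron. In them `0 ≤ lam` is a regular tetrahedron and `0 ≤ lam ≤ 2` a regular octahedron. The
planes where some `lam` is an integer cut both into unit cells, indexed by the lower corner `f`. A
cell with corner sum 3 is an upright tetrahedron, with sum 2 an octahedron, with sum 1 an inverted
tetrahedron.

Every permutation `σ` of the coordinates, multiplied by its sign, is a proper motion. Even ones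
preserve the kind of a cell; odd ones reverse all coordinates and replace the corner sum `S` by `4 -
S`. Each cell is moved to a cell so that every facet of the new place lying on the surface receives
a facet that was internal. In the octahedron each cell turns within its own place. In the
tetrahedron, of edge four cells, a corner cell has only one internal facet, so the four corner cells
change places with the four inverted cells, all of whose facets are internal; the rest turn in
place. That suitable `σ` exist is a finite check (`exists_cellMove`).

Thus each regular solid is reassembled onto itself (`selfDissectable_body`). This stronger property
passes to a union of non-overlapping solids (`SelfDissectable.of_isDecomposition`): surface points
of the union are surface points of a part, and cuts internal to a part are internal to the union. -/

/-! ### Tetrahedral coordinates and the boxes they bound. -/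

/-- Integer sign vectors of the four face normals of a regular tetrahedron inscribed in a cube. -/
def faceNormal : Fin 4 → Fin 3 → ℤ :=
  ![![1, 1, 1], ![1, -1, -1], ![-1, 1, -1], ![-1, -1, 1]]

/-- The four barycentric-type coordinates (of sum `4`) of a point of space, at scale `r`. -/
noncomputable def lam (r : ℝ) (p : Space) (i : Fin 4) : ℝ := 1 + (∑ k, (faceNormal i k : ℝ) * p k) / r

def boxBody (r : ℝ) (a b : Fin 4 → ℝ) : Set Space :=
  {p | ∀ i, a i ≤ lam r p i ∧ lam r p i ≤ b i}

theorem sum_lam (r : ℝ) (p : Space) : ∑ i, lam r p i = 4 := by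
  simp [lam, faceNormal, Fin.sum_univ_four, Fin.sum_univ_three]
  ring

/-- Distinct face normals have inner product -1 and each has square norm 3, so the transposed matrix
divided by 4 inverts `lam` on the hyperplane of sum 4. -/
theorem exists_lam_eq {r : ℝ} (hr : r ≠ 0) (l : Fin 4 → ℝ) (hl : ∑ i, l i = 4) :
    ∃ p, ∀ i, lam r p i = l i := by
  refine ⟨WithLp.toLp 2 (fun k => r / 4 * ∑ i, (faceNormal i k : ℝ) * l i), fun i => ?_⟩
  have h : l 0 = 4 - l 1 - l 2 - l 3 := by
    rw [Fin.sum_univ_four] at hl; linarith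
  fin_cases i <;> simp [lam, faceNormal, Fin.sum_univ_four, Fin.sum_univ_three, h] <;>
    field_simp <;> ring

theorem lam_injective {r : ℝ} (hr : r ≠ 0) {p q : Space} (h : ∀ i, lam r p i = lam r q i) :
    p = q := by
  have h0 := h 0
  have h1 := h 1
  have h2 := h 2
  simp only [lam, faceNormal, Fin.sum_univ_three, add_right_inj, div_left_inj' hr] at h0 h1 h2
  simp at h0 h1 h2
  ext k
  fin_cases k <;> simp <;> linarith

theorem lam_add_smul (r : ℝ) (p q : Space) {a b : ℝ} (hab : a + b = 1) (i : Fin 4) :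
    lam r (a • p + b • q) i = a * lam r p i + b * lam r q i := by
  obtain rfl : b = 1 - a := by linarith
  simp [lam, Fin.sum_univ_three]
  ring

theorem lam_sum {ι : Type*} [Fintype ι] (r : ℝ) (w : ι → ℝ) (hw : ∑ j, w j = 1) (v : ι → Space)
    (i : Fin 4) : lam r (∑ j, w j • v j) i = ∑ j, w j * lam r (v j) i := by
  simp only [lam, mul_add, mul_one, Finset.sum_add_distrib, hw]
  congr 1
  simp only [WithLp.ofLp_sum, Finset.sum_apply, PiLp.smul_apply, smul_eq_mul, Fin.sum_univ_three,
    Finset.mul_sum, ← mul_div_assoc, mul_add, add_div, Finset.sum_add_distrib, Finset.sum_div]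
  congr 1
  · congr 1 <;> exact Finset.sum_congr rfl fun j _ => by ring
  · exact Finset.sum_congr rfl fun j _ => by ring

theorem lam_add (r : ℝ) (p q : Space) (i : Fin 4) :
    lam r (p + q) i = lam r p i + lam r q i - 1 := by
  simp [lam, Fin.sum_univ_three]
  ring

theorem continuous_lam (r : ℝ) (i : Fin 4) : Continuous fun p => lam r p i := by
  unfold lam
  fun_prop

theorem isOpenMap_lam {r : ℝ} (hr : r ≠ 0) (i : Fin 4) : IsOpenMap fun p => lam r p i := by
  let φ : Space →ₗ[ℝ] ℝ :=
    { toFun := fun p => (∑ k, (faceNormal i k : ℝ) * p k) / r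
      map_add' := fun p q => by simp [Fin.sum_univ_three]; ring
      map_smul' := fun c p => by simp [Fin.sum_univ_three]; ring }
  have hφ : Function.Surjective φ := by
    apply LinearMap.surjective
    intro h0
    have := LinearMap.congr_fun h0 (EuclideanSpace.single 0 1)
    fin_cases i <;> simp [φ, faceNormal, Fin.sum_univ_three, hr] at this
  exact (Homeomorph.addLeft (1 : ℝ)).isOpenMap.comp (LinearMap.isOpenMap_of_finiteDimensional φ hφ)

theorem convex_boxBody (r : ℝ) (a b : Fin 4 → ℝ) : Convex ℝ (boxBody r a b) := by
  intro p hp q hq s t hs ht hst i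
  rw [lam_add_smul r p q hst]
  obtain ⟨h1, h2⟩ := hp i
  obtain ⟨h3, h4⟩ := hq i
  obtain rfl : t = 1 - s := by linarith
  constructor <;> nlinarith

theorem isClosed_boxBody (r : ℝ) (a b : Fin 4 → ℝ) : IsClosed (boxBody r a b) := by
  simp only [boxBody, Set.ofPred_forall, Set.ofPred_and]
  exact isClosed_iInter fun i => (isClosed_le continuous_const (continuous_lam r i)).inter
    (isClosed_le (continuous_lam r i) continuous_const)

theorem mem_interior_boxBody_iff {r : ℝ} (hr : r ≠ 0) {a b : Fin 4 → ℝ} {p : Space} :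
    p ∈ interior (boxBody r a b) ↔ ∀ i, a i < lam r p i ∧ lam r p i < b i := by
  constructor
  · intro hp i
    have h : interior (boxBody r a b) ⊆ (fun p => lam r p i) ⁻¹' interior (Set.Icc (a i) (b i)) := by
      rw [(isOpenMap_lam hr i).preimage_interior_eq_interior_preimage (continuous_lam r i)]
      exact interior_mono fun p hp => hp i
    simpa using h hp
  · intro hp
    refine mem_interior.2 ⟨{p | ∀ i, a i < lam r p i ∧ lam r p i < b i}, fun p hp i =>
      ⟨(hp i).1.le, (hp i).2.le⟩, ?_, hp⟩
    simp only [Set.ofPred_forall, Set.ofPred_and]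
    exact isOpen_iInter_of_finite fun i => (isOpen_lt continuous_const (continuous_lam r i)).inter
      (isOpen_lt (continuous_lam r i) continuous_const)

theorem mem_frontier_boxBody_iff {r : ℝ} (hr : r ≠ 0) {a b : Fin 4 → ℝ} {p : Space} :
    p ∈ frontier (boxBody r a b) ↔
      p ∈ boxBody r a b ∧ ∃ i, lam r p i = a i ∨ lam r p i = b i := by
  rw [(isClosed_boxBody r a b).frontier_eq, Set.mem_sdiff, mem_interior_boxBody_iff hr]
  refine and_congr_right fun hp => ?_
  push Not
  refine exists_congr fun i => ?_
  obtain ⟨h1, h2⟩ := hp i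
  constructor
  · intro h
    rcases h1.lt_or_eq with h3 | h3
    · exact Or.inr (le_antisymm h2 (h h3))
    · exact Or.inl h3.symm
  · rintro (h | h) h3
    · linarith
    · exact h.ge

theorem disjoint_interior_boxBody {r : ℝ} (hr : r ≠ 0) {a b a' b' : Fin 4 → ℝ} (i : Fin 4)
    (h : b i ≤ a' i) : Disjoint (interior (boxBody r a b)) (interior (boxBody r a' b')) := by
  rw [Set.disjoint_left]
  intro p hp hp'
  have h1 := ((mem_interior_boxBody_iff hr).1 hp i).2
  have h2 := ((mem_interior_boxBody_iff hr).1 hp' i).1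
  linarith

/-- A point of a face of a box lies in the closure of the internal part of that face as soon as
the face contains some internal point. -/
theorem mem_internalCuts_boxBody {r : ℝ} (hr : r ≠ 0) {a b a' b' : Fin 4 → ℝ} {p m : Space}
    {j : Fin 4} {c : ℝ} (hc : c = a j ∨ c = b j) (hp : p ∈ boxBody r a b) (hpj : lam r p j = c)
    (hm : m ∈ boxBody r a b) (hmj : lam r m j = c) (hp' : p ∈ boxBody r a' b')
    (hm' : m ∈ interior (boxBody r a' b')) :
    p ∈ internalCuts (boxBody r a' b') (boxBody r a b) := by
  -- The segment towards `m` stays in the facet, and by convexity it is interior to the big box from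
  -- the first moment on.
  have hsub : openSegment ℝ p m ⊆ frontier (boxBody r a b) ∩ interior (boxBody r a' b') := by
    intro x hx
    refine ⟨(mem_frontier_boxBody_iff hr).2
      ⟨(convex_boxBody r a b).openSegment_subset hp hm hx, j, ?_⟩,
      (convex_boxBody r a' b').openSegment_self_interior_subset_interior hp' hm' hx⟩
    obtain ⟨s, t, -, -, hst, rfl⟩ := hx
    have : lam r (s • p + t • m) j = c := by
      rw [lam_add_smul r p m hst, hpj, hmj, ← add_mul, hst, one_mul]
    rwa [this]
  refine closure_mono hsub ?_
  rw [closure_openSegment]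
  exact left_mem_segment ℝ p m

/-! ### Proper motions that permute the coordinates. -/

/-- Four times the matrix of the symmetry of a regular tetrahedron that permutes the faces
by `σ`. -/
def permMatrix (σ : Equiv.Perm (Fin 4)) : Matrix (Fin 3) (Fin 3) ℤ :=
  Matrix.of fun k l => ∑ i, faceNormal i k * faceNormal (σ i) l

/-- A transposition of two faces is a reflection; the factor is `4 ^ 3`. Multiplying by the sign in
odd dimension therefore makes every determinant positive. -/
theorem det_permMatrix (σ : Equiv.Perm (Fin 4)) :
    (permMatrix σ).det = 64 * (Equiv.Perm.sign σ : ℤ) := by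
  revert σ
  simp only [Matrix.det_fin_three]
  decide +kernel

theorem faceNormal_permMatrix (σ : Equiv.Perm (Fin 4)) (i : Fin 4) (l : Fin 3) :
    ∑ k, faceNormal i k * permMatrix σ k l = 4 * faceNormal (σ i) l := by
  revert σ i l
  decide +kernel

/-- The orthogonal map permuting the face normals by `σ`, multiplied by the sign of `σ`. -/
noncomputable def permLin (σ : Equiv.Perm (Fin 4)) : Space →ₗ[ℝ] Space :=
  Matrix.toEuclideanLin
    (((Equiv.Perm.sign σ : ℤ) / 4 : ℝ) • (permMatrix σ).map (Int.castRingHom ℝ))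

theorem det_permLin (σ : Equiv.Perm (Fin 4)) : LinearMap.det (permLin σ) = 1 := by
  rw [permLin, Matrix.toEuclideanLin_eq_toLin_orthonormal, LinearMap.det_toLin, Matrix.det_smul,
    ← RingHom.mapMatrix_apply, ← RingHom.map_det, det_permMatrix]
  rcases Int.units_eq_one_or (Equiv.Perm.sign σ) with h | h <;> rw [h] <;> norm_num

theorem faceNormal_permLin (σ : Equiv.Perm (Fin 4)) (p : Space) (i : Fin 4) :
    ∑ k, (faceNormal i k : ℝ) * permLin σ p k =
      (Equiv.Perm.sign σ : ℤ) * ∑ k, (faceNormal (σ i) k : ℝ) * p k := by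
  have h : ∀ l, ∑ k, (faceNormal i k : ℝ) * (permMatrix σ k l : ℝ) = 4 * faceNormal (σ i) l :=
    fun l => by exact_mod_cast congrArg (Int.cast : ℤ → ℝ) (faceNormal_permMatrix σ i l)
  have h0 := h 0
  have h1 := h 1
  have h2 := h 2
  simp only [Fin.sum_univ_three] at h0 h1 h2
  simp only [permLin, Matrix.toLpLin_apply, Matrix.mulVec, dotProduct,
    Fin.sum_univ_three, Matrix.smul_apply, Matrix.map_apply, smul_eq_mul, eq_intCast]
  linear_combination ((Equiv.Perm.sign σ : ℤ) / 4 : ℝ) * (p 0 * h0 + p 1 * h1 + p 2 * h2)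

/-- The columns of `faceNormal` are orthogonal of square norm 4. The right side is symmetric in the
four normals, which makes `permLin` an isometry. -/
theorem norm_sq_eq_sum_faceNormal (p : Space) :
    ‖p‖ ^ 2 = (∑ i, (∑ k, (faceNormal i k : ℝ) * p k) ^ 2) / 4 := by
  rw [EuclideanSpace.real_norm_sq_eq]
  simp [faceNormal, Fin.sum_univ_three, Fin.sum_univ_four]
  ring

theorem norm_permLin (σ : Equiv.Perm (Fin 4)) (p : Space) : ‖permLin σ p‖ = ‖p‖ := by
  rw [← sq_eq_sq₀ (norm_nonneg _) (norm_nonneg _), norm_sq_eq_sum_faceNormal,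
    norm_sq_eq_sum_faceNormal]
  simp only [faceNormal_permLin, mul_pow]
  have : ((Equiv.Perm.sign σ : ℤ) : ℝ) ^ 2 = 1 := by
    rcases Int.units_eq_one_or (Equiv.Perm.sign σ) with h | h <;> rw [h] <;> norm_num
  simp only [this, one_mul]
  rw [Equiv.sum_comp σ fun i => (∑ k, (faceNormal i k : ℝ) * p k) ^ 2]

/-- The condition on `t` is forced, since the coordinates sum to 4 both before and after the motion.
-/
theorem exists_properMotion_lam {r : ℝ} (hr : r ≠ 0) (σ : Equiv.Perm (Fin 4)) (t : Fin 4 → ℝ)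
    (ht : ∑ i, t i = 4 - 4 * ((Equiv.Perm.sign σ : ℤ) : ℝ)) :
    ∃ g : Space ≃ᵃⁱ[ℝ] Space, IsProperMotion g ∧
      ∀ p i, lam r (g p) i = t i + (Equiv.Perm.sign σ : ℤ) * lam r p (σ i) := by
  let R : Space ≃ₗᵢ[ℝ] Space :=
    LinearIsometry.toLinearIsometryEquiv ⟨permLin σ, norm_permLin σ⟩ rfl
  have hR : ∀ p, R p = permLin σ p := fun p => rfl
  obtain ⟨c, hc⟩ := exists_lam_eq hr (fun i => t i + (Equiv.Perm.sign σ : ℤ))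
    (by rw [Finset.sum_add_distrib, ht]; simp)
  refine ⟨R.toAffineIsometryEquiv.trans (AffineIsometryEquiv.constVAdd ℝ Space c), ?_, ?_⟩
  · rw [IsProperMotion, ← det_permLin σ]
    congr 1
  · intro p i
    have : (R.toAffineIsometryEquiv.trans (AffineIsometryEquiv.constVAdd ℝ Space c)) p
        = c + permLin σ p := rfl
    rw [this, lam_add, hc]
    simp only [lam, faceNormal_permLin]
    ring

/-! ### Cells and their covering of the body. -/

/-- Indices of the cells of the body `0 ≤ lam ≤ M`. -/
abbrev IsCellIndex (M : ℕ) (f : Fin 4 → Fin 4) : Prop :=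
  1 ≤ ∑ i, (f i : ℕ) ∧ ∑ i, (f i : ℕ) ≤ 3 ∧ ∀ i, (f i : ℕ) + 1 ≤ M

/-- The cell with lower corner `f`. -/
def cell (r : ℝ) (f : Fin 4 → Fin 4) : Set Space :=
  boxBody r (fun i => ((f i : ℕ) : ℝ)) (fun i => ((f i : ℕ) : ℝ) + 1)

/-- The regular tetrahedron (`M ≥ 4`) or octahedron (`M = 2`) of scale `r`. -/
def body (r : ℝ) (M : ℕ) : Set Space :=
  boxBody r (fun _ => 0) (fun _ => (M : ℝ))

theorem exists_decrement (n : Fin 4 → ℕ) (j : Fin 4) (hj : 1 ≤ n j) :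
    ∃ f : Fin 4 → ℕ, (∀ i, f i = n i ∨ (f i + 1 = n i)) ∧
      ∑ i, f i + 1 = ∑ i, n i := by
  refine ⟨fun i => n i - if i = j then 1 else 0, fun i => ?_, ?_⟩
  · by_cases h : i = j
    · subst h; right; simp; omega
    · simp [h]
  · have h : ∀ i, n i = (n i - if i = j then 1 else 0) + if i = j then 1 else 0 := by
      intro i
      by_cases h : i = j
      · subst h; simp; omega
      · simp [h]
    conv_rhs => rw [Finset.sum_congr rfl fun i _ => h i, Finset.sum_add_distrib]
    simp

/-- The floor, except at the endpoint `M`, where `M - 1` keeps the unit interval inside the body. -/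
theorem exists_truncated_floor {M : ℕ} (hM : 1 ≤ M) (x : ℝ) (h0 : 0 ≤ x) (h1 : x ≤ M) :
    ∃ n : ℕ, n ≤ x ∧ x ≤ n + 1 ∧ n + 1 ≤ M ∧ (x < n + 1 ∨ x = M) := by
  rcases h1.lt_or_eq with h | h
  · refine ⟨⌊x⌋₊, Nat.floor_le h0, (Nat.lt_floor_add_one x).le, ?_, Or.inl (Nat.lt_floor_add_one x)⟩
    exact (Nat.floor_lt h0).2 h
  · refine ⟨M - 1, ?_, ?_, by omega, Or.inr h⟩ <;> rw [Nat.cast_sub hM] <;> push_cast <;> linarith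

theorem exists_fin_valued {f : Fin 4 → ℕ} (h : ∑ i, f i ≤ 3) :
    ∃ f' : Fin 4 → Fin 4, ∀ i, ((f' i : Fin 4) : ℕ) = f i :=
  ⟨fun i => ⟨f i, by
    have := Finset.single_le_sum (f := f) (fun _ _ => Nat.zero_le _) (Finset.mem_univ i)
    omega⟩, fun i => rfl⟩

/-- Truncated floors give the index, unless they sum to 4: then the point is a lattice point and one
coordinate is lowered. The last clause serves the surface: only cells of sum at least 2 have
two-dimensional lower facets. Taking 5 rather than 4 for the tetrahedron keeps its vertices off the
upper bound. -/
theorem exists_cellIndex_aux {M : ℕ} (hM : M = 2 ∨ M = 5) (l : Fin 4 → ℝ) (hl : ∑ i, l i = 4)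
    (h : ∀ i, 0 ≤ l i ∧ l i ≤ M) :
    ∃ f : Fin 4 → Fin 4, IsCellIndex M f ∧ (∀ i, (f i : ℕ) ≤ l i ∧ l i ≤ (f i : ℕ) + 1) ∧
      ((∃ i, l i = 0) → 2 ≤ ∑ i, (f i : ℕ)) := by
  have hM1 : 1 ≤ M := by omega
  choose n hn1 hn2 hn3 hn4 using fun i => exists_truncated_floor hM1 (l i) (h i).1 (h i).2
  have hle : ∑ i, n i ≤ 4 := by
    have : ∑ i, (n i : ℝ) ≤ 4 := hl ▸ Finset.sum_le_sum fun i _ => hn1 i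
    exact_mod_cast this
  by_cases h4 : ∑ i, n i = 4
  · have heq : ∀ i, l i = n i := by
      have h5 : ∑ i, (n i : ℝ) = ∑ i, l i := by rw [hl]; exact_mod_cast h4
      intro i
      exact ((Finset.sum_eq_sum_iff_of_le fun i _ => hn1 i).1 h5 i (Finset.mem_univ i)).symm
    obtain ⟨j, hj⟩ : ∃ j, 1 ≤ n j := by
      by_contra! hc
      have : ∑ i, n i = 0 := Finset.sum_eq_zero fun i _ => by have := hc i; omega
      omega
    obtain ⟨f, hf1, hf2⟩ := exists_decrement n j hj
    obtain ⟨f', hf'⟩ := exists_fin_valued (f := f) (by omega)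
    refine ⟨f', ⟨?_, ?_, ?_⟩, ?_, ?_⟩ <;> simp only [hf']
    · omega
    · omega
    · intro i
      have := hn3 i
      rcases hf1 i with h6 | h6 <;> omega
    · intro i
      rw [heq i]
      rcases hf1 i with h6 | h6
      · rw [h6]; constructor <;> linarith
      · rw [← h6]; push_cast; constructor <;> linarith
    · omega
  · have hMr : (M : ℝ) = 2 ∨ (M : ℝ) = 5 := by
      rcases hM with rfl | rfl <;> norm_num
    have h1 : 1 ≤ ∑ i, n i := by
      by_contra! hc
      have h0 : ∀ i, n i = 0 := by
        intro i
        have := Finset.single_le_sum (f := n) (fun _ _ => Nat.zero_le _) (Finset.mem_univ i)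
        omega
      have h7 : ∀ i, l i ≤ 1 := fun i => by have := hn2 i; rw [h0 i] at this; simpa using this
      have h8 : ∀ i, l i = 1 := by
        have h5 : ∑ i, l i = ∑ i : Fin 4, (1 : ℝ) := by rw [hl]; norm_num
        intro i
        exact (Finset.sum_eq_sum_iff_of_le fun i _ => h7 i).1 h5 i (Finset.mem_univ i)
      have h9 := hn4 0
      rw [h0 0, h8 0] at h9
      rcases hMr with h | h <;> norm_num [h] at h9
    obtain ⟨f', hf'⟩ := exists_fin_valued (f := n) (by omega)
    refine ⟨f', ⟨?_, ?_, ?_⟩, ?_, ?_⟩ <;> simp only [hf']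
    · omega
    · omega
    · exact hn3
    · exact fun i => ⟨hn1 i, hn2 i⟩
    · rintro ⟨i, hi⟩
      by_contra! hc
      have hs : ∑ i, (n i : ℝ) = 1 := by exact_mod_cast (by omega : ∑ i, n i = 1)
      have h9 := hn1 i
      rw [hi] at h9
      simp only [Fin.sum_univ_four] at hl hs
      -- With corner sum 1 and `l i = 0`, the other three coordinates must all be maximal to reach
      -- 4. By truncation they equal `M`, but `3 * M` is not 4.
      have key : ∀ j, j ≠ i → l j = n j + 1 := by
        intro j hj
        have b0 := hn2 0
        have b1 := hn2 1
        have b2 := hn2 2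
        have b3 := hn2 3
        fin_cases i <;> fin_cases j <;> simp at hj hi h9 ⊢ <;> linarith
      have key2 : ∀ j, j ≠ i → l j = M := by
        intro j hj
        rcases hn4 j with h10 | h10
        · have := key j hj; linarith
        · exact h10
      have c0 := key2 0
      have c1 := key2 1
      have c2 := key2 2
      have c3 := key2 3
      fin_cases i <;> simp at c0 c1 c2 c3 hi <;> rcases hMr with h | h <;> linarith

/-- The cells cover the body, and a point on a lower face lies on a lower facet of a cell. -/
theorem exists_cell_of_mem_body {M : ℕ} (hM : M = 2 ∨ M = 5) {r : ℝ} {p : Space}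
    (hp : p ∈ body r M) : ∃ f, IsCellIndex M f ∧ p ∈ cell r f ∧
      ((∃ i, lam r p i = 0) → 2 ≤ ∑ i, (f i : ℕ)) :=
  exists_cellIndex_aux hM (lam r p) (sum_lam r p) hp

/-- A point on an upper face lies on an upper facet of a cell. -/
theorem exists_cell_of_upper {M : ℕ} (hM : M = 2 ∨ M = 5) {r : ℝ} {p : Space}
    (hp : p ∈ body r M) {i : Fin 4} (hi : lam r p i = M) :
    ∃ f, IsCellIndex M f ∧ p ∈ cell r f ∧ ∑ i, (f i : ℕ) ≤ 2 := by
  have hs := sum_lam r p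
  rcases hM with rfl | rfl
  swap
  · exfalso
    have : lam r p i ≤ ∑ i, lam r p i :=
      Finset.single_le_sum (f := lam r p) (fun i _ => (hp i).1) (Finset.mem_univ i)
    push_cast at hi
    linarith
  -- The central symmetry `lam ↦ 2 - lam` of the octahedron exchanges upper and lower faces.
  obtain ⟨f, ⟨hf1, hf2, hf3⟩, hfp, hf⟩ := exists_cellIndex_aux (Or.inl rfl)
    (fun i => 2 - lam r p i) (by rw [Finset.sum_sub_distrib, hs]; norm_num)
    (fun i => by have := hp i; push_cast at this ⊢; constructor <;> linarith)
  have h2 := hf ⟨i, by push_cast at hi; linarith⟩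
  have hv : ∀ i, ((1 - f i : Fin 4) : ℕ) + f i = 1 := by
    intro i
    have := hf3 i
    generalize f i = x at *
    revert x
    decide
  have hsum : ∑ i, ((1 - f i : Fin 4) : ℕ) + ∑ i, (f i : ℕ) = 4 := by
    rw [← Finset.sum_add_distrib, Finset.sum_congr rfl fun i _ => hv i]
    simp
  refine ⟨fun i => 1 - f i, ⟨?_, ?_, fun i => ?_⟩, fun i => ?_, ?_⟩ <;> beta_reduce
  · omega
  · omega
  · have := hv i; omega
  swap
  · omega
  have h3 : (((1 - f i : Fin 4) : ℕ) : ℝ) + (f i : ℕ) = 1 := by exact_mod_cast hv i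
  have h4 := hfp i
  constructor <;> linarith

/-! ### Tetrahedra and octahedra in coordinates. -/

theorem isPolyhedron_iUnion {ι : Type*} [Finite ι] [Nonempty ι] (v : ι → Fin 4 → Space)
    (hv : ∀ i, AffineIndependent ℝ (v i)) :
    IsPolyhedron (⋃ i, convexHull ℝ (Set.range (v i))) := by
  obtain ⟨n, ⟨e⟩⟩ := Finite.exists_equiv_fin ι
  obtain ⟨n, rfl⟩ : ∃ m, n = m + 1 := by
    refine Nat.exists_eq_succ_of_ne_zero ?_
    rintro rfl
    exact (e (Classical.arbitrary ι)).elim0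
  exact ⟨n, fun j => v (e.symm j), fun j => hv _,
    (e.symm.surjective.iUnion_comp fun i => convexHull ℝ (Set.range (v i))).symm⟩

theorem isPolyhedron_convexHull {v : Fin 4 → Space} (hv : AffineIndependent ℝ v) :
    IsPolyhedron (convexHull ℝ (Set.range v)) := by
  rw [← Set.iUnion_const (ι := Unit) (convexHull ℝ (Set.range v))]
  exact isPolyhedron_iUnion (fun _ : Unit => v) fun _ => hv

section Tetrahedra

variable {r d : ℝ} {a : Fin 4 → ℝ} {v : Fin 4 → Space}

/-- The quotients are the barycentric coordinates. Negative `d` covers the inverted tetrahedra. -/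
theorem convexHull_eq_of_lam (hr : r ≠ 0) (hd : d ≠ 0) (ha : ∑ i, a i + d = 4)
    (hv : ∀ i j, lam r (v i) j = a j + if i = j then d else 0) :
    convexHull ℝ (Set.range v) = {p | ∀ j, 0 ≤ (lam r p j - a j) / d} := by
  apply Set.Subset.antisymm
  · refine convexHull_min ?_ ?_
    · rintro _ ⟨i, rfl⟩ j
      rw [hv]
      by_cases h : i = j <;> simp [h, hd]
    · intro p hp q hq s t hs ht hst j
      rw [lam_add_smul r p q hst]
      have h1 : (s * lam r p j + t * lam r q j - a j) / d =
          s * ((lam r p j - a j) / d) + t * ((lam r q j - a j) / d) := by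
        obtain rfl : t = 1 - s := by linarith
        ring
      rw [h1]
      exact add_nonneg (mul_nonneg hs (hp j)) (mul_nonneg ht (hq j))
  · intro p hp
    have hw : ∑ j, (lam r p j - a j) / d = 1 := by
      rw [← Finset.sum_div, Finset.sum_sub_distrib, sum_lam, div_eq_one_iff_eq hd]
      linarith
    have hpe : p = ∑ j, ((lam r p j - a j) / d) • v j := by
      apply lam_injective hr
      intro i
      rw [lam_sum r _ hw]
      simp only [hv, mul_add, Finset.sum_add_distrib, ← Finset.sum_mul, hw]
      simp [hd]
    rw [hpe]
    exact (convex_convexHull ℝ _).sum_mem (fun j _ => hp j) hw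
      fun j _ => subset_convexHull ℝ _ ⟨j, rfl⟩

theorem affineIndependent_of_lam (hd : d ≠ 0)
    (hv : ∀ i j, lam r (v i) j = a j + if i = j then d else 0) : AffineIndependent ℝ v := by
  rw [affineIndependent_iff_of_fintype]
  intro w hw hw0 i
  rw [Finset.univ.weightedVSub_eq_linear_combination hw] at hw0
  have h : ∑ j, w j * lam r (v j) i = 0 := by
    -- Weights of sum 0 are shifted by a unit mass at one vertex, because `lam` is affine and
    -- `lam_sum` needs sum 1.
    have h1 : ∑ j, (w j + if j = 0 then 1 else 0) = 1 := by
      rw [Finset.sum_add_distrib, hw]; simp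
    have h2 := lam_sum r (fun j => w j + if j = 0 then 1 else 0) h1 v i
    simp only [add_smul, add_mul, Finset.sum_add_distrib, hw0] at h2
    simpa using h2
  simp only [hv, mul_add, Finset.sum_add_distrib, ← Finset.sum_mul, hw] at h
  simpa [hd] using h

theorem exists_tetrahedron_vertices (hr : r ≠ 0) (ha : ∑ i, a i + d = 4) :
    ∃ v : Fin 4 → Space, ∀ i j, lam r (v i) j = a j + if i = j then d else 0 := by
  choose v hv using fun i : Fin 4 => exists_lam_eq hr (fun j => a j + if i = j then d else 0)
    (by rw [Finset.sum_add_distrib]; simpa using ha)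
  exact ⟨v, hv⟩

end Tetrahedra

section Octahedra

/-- The closed ball of radius `ρ` around `c` in the `ℓ¹` norm. -/
def octa (c : Space) (ρ : ℝ) : Set Space := {p | ∑ k, |p k - c k| ≤ ρ}

/-- The tetrahedron with vertex `c` and edges along the signed coordinate axes. -/
noncomputable def octant (c : Space) (ρ : ℝ) (s : Fin 3 → SignType) : Fin 4 → Space :=
  Fin.cons c fun k => c + (ρ * (s k : ℝ)) • EuclideanSpace.single k 1

theorem convex_octa (c : Space) (ρ : ℝ) : Convex ℝ (octa c ρ) := by
  intro p hp q hq s t hs ht hst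
  obtain rfl : t = 1 - s := by linarith
  have h : ∀ k, |(s • p + (1 - s) • q) k - c k| ≤ s * |p k - c k| + (1 - s) * |q k - c k| := by
    intro k
    have : (s • p + (1 - s) • q) k - c k = s * (p k - c k) + (1 - s) * (q k - c k) := by
      simp; ring
    rw [this]
    refine (abs_add_le _ _).trans_eq ?_
    rw [abs_mul, abs_mul, abs_of_nonneg hs, abs_of_nonneg ht]
  calc _ ≤ ∑ k, (s * |p k - c k| + (1 - s) * |q k - c k|) := Finset.sum_le_sum fun k _ => h k
    _ = s * ∑ k, |p k - c k| + (1 - s) * ∑ k, |q k - c k| := by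
      rw [Finset.sum_add_distrib, Finset.mul_sum, Finset.mul_sum]
    _ ≤ s * ρ + (1 - s) * ρ :=
      add_le_add (mul_le_mul_of_nonneg_left hp hs) (mul_le_mul_of_nonneg_left hq ht)
    _ = ρ := by ring

theorem octant_subset_octa (c : Space) {ρ : ℝ} (hρ : 0 ≤ ρ) (s : Fin 3 → SignType) :
    convexHull ℝ (Set.range (octant c ρ s)) ⊆ octa c ρ := by
  refine convexHull_min ?_ (convex_octa c ρ)
  rintro _ ⟨i, rfl⟩
  refine Fin.cases ?_ (fun k => ?_) i
  · simp [octant, octa, hρ]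
  · have h : |ρ * (s k : ℝ)| ≤ ρ := by
      rw [abs_mul, abs_of_nonneg hρ]
      cases s k <;> simp [hρ]
    simp only [octant, Fin.cons_succ]
    fin_cases k <;> simpa [octa, Fin.sum_univ_three] using h

theorem mem_octant {c p : Space} {ρ : ℝ} (hρ : 0 < ρ) (hp : p ∈ octa c ρ) :
    ∃ s : Fin 3 → SignType, (∀ k, s k ≠ 0) ∧ p ∈ convexHull ℝ (Set.range (octant c ρ s)) := by
  have hs : ∀ x : ℝ, ∃ s : SignType, s ≠ 0 ∧ x = |x| * s := by
    intro x
    rcases le_total 0 x with h | h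
    · exact ⟨1, by decide, by simp [abs_of_nonneg h]⟩
    · exact ⟨-1, by decide, by simp [abs_of_nonpos h]⟩
  choose s hs0 hs using fun k => hs (p k - c k)
  refine ⟨s, hs0, ?_⟩
  have hpe : p = (1 - ∑ k, |p k - c k| / ρ) • octant c ρ s 0 +
      ∑ k : Fin 3, (|p k - c k| / ρ) • octant c ρ s k.succ := by
    have h : ∀ k, |p k - c k| / ρ * (ρ * (s k : ℝ)) = p k - c k := by
      intro k
      conv_rhs => rw [hs k]
      field_simp
    have h0 := h 0
    have h1 := h 1
    have h2 := h 2
    ext k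
    fin_cases k <;> simp [octant, Fin.sum_univ_three] <;> linarith
  have hw : ∑ i : Fin 4, (Fin.cons (1 - ∑ k, |p k - c k| / ρ) (fun k => |p k - c k| / ρ) :
      Fin 4 → ℝ) i = 1 := by
    rw [Fin.sum_univ_succ]
    simp
  rw [hpe]
  have := (convex_convexHull ℝ (Set.range (octant c ρ s))).sum_mem (t := Finset.univ)
    (w := Fin.cons (1 - ∑ k, |p k - c k| / ρ) (fun k => |p k - c k| / ρ))
    (z := octant c ρ s) ?_ hw fun j _ => subset_convexHull ℝ _ ⟨j, rfl⟩
  · rw [Fin.sum_univ_succ] at this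
    simpa only [Fin.cons_zero, Fin.cons_succ] using this
  · intro i _
    refine Fin.cases ?_ (fun k => ?_) i
    · rw [Fin.cons_zero, ← Finset.sum_div, sub_nonneg, div_le_one hρ]
      exact hp
    · rw [Fin.cons_succ]
      positivity

theorem affineIndependent_octant (c : Space) {ρ : ℝ} (hρ : ρ ≠ 0) {s : Fin 3 → SignType}
    (hs : ∀ k, s k ≠ 0) : AffineIndependent ℝ (octant c ρ s) := by
  rw [affineIndependent_iff_of_fintype]
  intro w hw hw0
  rw [Finset.univ.weightedVSub_eq_linear_combination hw] at hw0
  have hs' : ∀ k, (s k : ℝ) ≠ 0 := fun k => by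
    have := hs k
    revert this
    cases s k <;> simp
  have hk : ∀ k : Fin 3, w k.succ = 0 := by
    intro k
    have h := congrArg (fun q : Space => q k) hw0
    rw [Fin.sum_univ_succ] at hw
    simp only [Fin.sum_univ_succ (n := 3), octant, Fin.cons_zero, Fin.cons_succ, PiLp.add_apply,
      WithLp.ofLp_sum, Finset.sum_apply, PiLp.smul_apply, smul_eq_mul, mul_add,
      Finset.sum_add_distrib, ← Finset.sum_mul, PiLp.single_apply, PiLp.zero_apply,
      mul_ite, mul_one, mul_zero, Finset.sum_ite_eq, Finset.mem_univ, if_true] at h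
    have h' : w k.succ * (ρ * s k) = 0 := by linear_combination h - c k * hw
    simpa [hρ, hs' k] using h'
  intro i
  refine Fin.cases ?_ hk i
  rw [Fin.sum_univ_succ] at hw
  simpa [hk] using hw

theorem isPolyhedron_octa (c : Space) {ρ : ℝ} (hρ : 0 < ρ) : IsPolyhedron (octa c ρ) := by
  have : Nonempty {s : Fin 3 → SignType // ∀ k, s k ≠ 0} := ⟨⟨fun _ => 1, fun _ => one_ne_zero⟩⟩
  have h := isPolyhedron_iUnion (fun s : {s : Fin 3 → SignType // ∀ k, s k ≠ 0} => octant c ρ s)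
    fun s => affineIndependent_octant c hρ.ne' s.2
  convert h using 1
  apply Set.Subset.antisymm
  · intro p hp
    obtain ⟨s, hs, hps⟩ := mem_octant hρ hp
    exact Set.mem_iUnion.2 ⟨⟨s, hs⟩, hps⟩
  · exact Set.iUnion_subset fun s => octant_subset_octa c hρ.le s

theorem octa_eq_convexHull (c : Space) {ρ : ℝ} (hρ : 0 < ρ) :
    octa c ρ = convexHull ℝ
      (Set.range (fun i : Fin 3 => c + ρ • (EuclideanSpace.single i 1 : Space)) ∪
        Set.range (fun i : Fin 3 => c - ρ • (EuclideanSpace.single i 1 : Space))) := by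
  apply Set.Subset.antisymm
  · intro p hp
    obtain ⟨s, hs, hps⟩ := mem_octant hρ hp
    refine convexHull_min ?_ (convex_convexHull ℝ _) hps
    rintro _ ⟨i, rfl⟩
    refine Fin.cases ?_ (fun k => ?_) i
    · have h1 := subset_convexHull ℝ
        (Set.range (fun i : Fin 3 => c + ρ • (EuclideanSpace.single i 1 : Space)) ∪
          Set.range (fun i : Fin 3 => c - ρ • (EuclideanSpace.single i 1 : Space)))
        (Or.inl ⟨0, rfl⟩)
      have h2 := subset_convexHull ℝ
        (Set.range (fun i : Fin 3 => c + ρ • (EuclideanSpace.single i 1 : Space)) ∪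
          Set.range (fun i : Fin 3 => c - ρ • (EuclideanSpace.single i 1 : Space)))
        (Or.inr ⟨0, rfl⟩)
      -- The centre is the midpoint of two opposite vertices.
      have h3 := convex_convexHull ℝ _ h1 h2 (a := 1 / 2) (b := 1 / 2) (by norm_num) (by norm_num)
        (by norm_num)
      convert h3 using 1
      simp only [octant, Fin.cons_zero]
      module
    · apply subset_convexHull
      have := hs k
      rcases h : s k with _ | _ | _
      · exact absurd h this
      · right
        exact ⟨k, by simp [octant, h, sub_eq_add_neg]⟩
      · left
        exact ⟨k, by simp [octant, h]⟩
  · refine convexHull_min ?_ (convex_octa c ρ)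
    rintro _ (⟨i, rfl⟩ | ⟨i, rfl⟩) <;>
      fin_cases i <;> simp [octa, Fin.sum_univ_three, abs_of_pos hρ]

/-- Up to sign, the four normals are all eight sign vectors, so the largest of these absolute values
is the `ℓ¹` norm. -/
theorem sum_abs_le_iff (x : Fin 3 → ℝ) (ρ : ℝ) :
    ∑ k, |x k| ≤ ρ ↔ ∀ i, |∑ k, (faceNormal i k : ℝ) * x k| ≤ ρ := by
  constructor
  · intro h i
    refine (Finset.abs_sum_le_sum_abs _ _).trans (le_of_eq_of_le ?_ h)
    refine Finset.sum_congr rfl fun k _ => ?_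
    rw [abs_mul]
    fin_cases i <;> fin_cases k <;> simp [faceNormal]
  · intro h
    have h0 := abs_le.1 (h 0)
    have h1 := abs_le.1 (h 1)
    have h2 := abs_le.1 (h 2)
    have h3 := abs_le.1 (h 3)
    simp [faceNormal, Fin.sum_univ_three] at h0 h1 h2 h3
    rw [Fin.sum_univ_three]
    rcases abs_cases (x 0) with ⟨e0, -⟩ | ⟨e0, -⟩ <;> rcases abs_cases (x 1) with ⟨e1, -⟩ | ⟨e1, -⟩ <;>
      rcases abs_cases (x 2) with ⟨e2, -⟩ | ⟨e2, -⟩ <;> rw [e0, e1, e2] <;> linarith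

theorem octa_eq_lam {r : ℝ} (hr : 0 < r) (c : Space) (d : ℝ) :
    octa c (r * d) = {p | ∀ i, |lam r p i - lam r c i| ≤ d} := by
  ext p
  have h : ∀ i, lam r p i - lam r c i = (∑ k, (faceNormal i k : ℝ) * (p k - c k)) / r := by
    intro i
    simp only [lam, mul_sub, Finset.sum_sub_distrib]
    ring
  simp only [octa, Set.mem_ofPred_eq, h, abs_div, abs_of_pos hr, div_le_iff₀ hr]
  rw [mul_comm r d]
  exact sum_abs_le_iff (fun k => p k - c k) (d * r)

end Octahedra

/-! ### Moving the cells. -/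

/-- `B` can be inside-out dissected in such a way that the pieces are reassembled to `B` itself. -/
def SelfDissectable (B : Set Space) : Prop :=
  ∃ (ι : Type) (_ : Finite ι) (Q : ι → Set Space) (g : ι → Space ≃ᵃⁱ[ℝ] Space),
    (∀ i, IsPolyhedron (Q i) ∧ IsConnected (interior (Q i))) ∧
    IsDecomposition B Q ∧ (∀ i, IsProperMotion (g i)) ∧
    IsDecomposition B (fun i => g i '' Q i) ∧
    frontier B ⊆ ⋃ i, g i '' internalCuts B (Q i)

/-- The cell of index `f` moved by `σ` to that of index `f'`. The conditions say that every facet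
of the new cell on the surface of the body comes from a facet inside the body. -/
abbrev IsCellMove (M : ℕ) (f f' : Fin 4 → Fin 4) (σ : Equiv.Perm (Fin 4)) : Prop :=
  (Equiv.Perm.sign σ = 1 ∧ ∑ i, (f i : ℕ) = ∑ i, (f' i : ℕ) ∧ ∀ i,
    (2 ≤ ∑ i, (f' i : ℕ) → f' i = 0 → f (σ i) ≠ 0) ∧
    (∑ i, (f' i : ℕ) ≤ 2 → (f' i : ℕ) + 1 = M → (f (σ i) : ℕ) + 1 ≠ M)) ∨
  (Equiv.Perm.sign σ = -1 ∧ ∑ i, (f i : ℕ) + ∑ i, (f' i : ℕ) = 4 ∧ ∀ i,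
    (2 ≤ ∑ i, (f' i : ℕ) → f' i = 0 → (f (σ i) : ℕ) + 1 ≠ M) ∧
    (∑ i, (f' i : ℕ) ≤ 2 → (f' i : ℕ) + 1 = M → f (σ i) ≠ 0))

/-- The cell to whose place the cell `f` is moved: in the octahedron itself; in the tetrahedron
the corner cells are exchanged with the inverted cells. -/
def cellTarget (M : ℕ) (f : Fin 4 → Fin 4) (i : Fin 4) : Fin 4 :=
  if M ≠ 2 ∧ ∀ k, k ≠ i → f k = 0 then - f i else f i

theorem cellTarget_spec : ∀ M ∈ ({2, 5} : Finset ℕ), ∀ f, IsCellIndex M f →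
    IsCellIndex M (cellTarget M f) ∧ cellTarget M (cellTarget M f) = f := by
  decide +kernel

/-- In the tetrahedron, octahedral cells turn by odd permutations, since their upper facets are all
internal; upright cells away from the corners turn by even ones. -/
theorem exists_cellMove : ∀ M ∈ ({2, 5} : Finset ℕ), ∀ f, IsCellIndex M f →
    ∃ σ, IsCellMove M f (cellTarget M f) σ := by
  decide +kernel

section Cells

variable {r : ℝ} {M : ℕ} {f : Fin 4 → Fin 4}

theorem isPolyhedron_cell (hr : 0 < r) (hf : IsCellIndex M f) : IsPolyhedron (cell r f) := by
  obtain ⟨h1, h2, -⟩ := hf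
  have hc : ((∑ i, (f i : ℕ) : ℕ) : ℝ) = ∑ i, ((f i : ℕ) : ℝ) := by push_cast; rfl
  obtain h | h | h : ∑ i, (f i : ℕ) = 1 ∨ ∑ i, (f i : ℕ) = 2 ∨ ∑ i, (f i : ℕ) = 3 := by omega
  all_goals rw [h] at hc; push_cast at hc
  · have ha : ∑ i, (((f i : ℕ) : ℝ) + 1) + (-1) = 4 := by
      rw [Finset.sum_add_distrib, ← hc]; norm_num
    obtain ⟨v, hv⟩ := exists_tetrahedron_vertices hr.ne' ha
    convert isPolyhedron_convexHull (affineIndependent_of_lam (by norm_num) hv) using 1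
    rw [convexHull_eq_of_lam hr.ne' (by norm_num) ha hv]
    ext p
    have hs := sum_lam r p
    simp only [Fin.sum_univ_four] at hs hc
    simp only [cell, boxBody, Set.mem_ofPred_eq, Fin.forall_fin_succ, Fin.forall_fin_zero, div_neg,
      div_one]
    simp
    constructor
    · rintro ⟨⟨-, _⟩, ⟨-, _⟩, ⟨-, _⟩, ⟨-, _⟩⟩
      refine ⟨?_, ?_, ?_, ?_⟩ <;> linarith
    · rintro ⟨_, _, _, _⟩
      refine ⟨⟨?_, ?_⟩, ⟨?_, ?_⟩, ⟨?_, ?_⟩, ⟨?_, ?_⟩⟩ <;> linarith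
  · obtain ⟨c, hcl⟩ := exists_lam_eq hr.ne' (fun i => ((f i : ℕ) : ℝ) + 1 / 2)
      (by rw [Finset.sum_add_distrib, ← hc]; norm_num)
    convert isPolyhedron_octa c (ρ := r * (1 / 2)) (by positivity) using 1
    rw [octa_eq_lam hr]
    ext p
    refine forall_congr' fun i => ?_
    rw [hcl, abs_le]
    refine and_congr ⟨fun h => ?_, fun h => ?_⟩ ⟨fun h => ?_, fun h => ?_⟩ <;> linarith
  · have ha : ∑ i, ((f i : ℕ) : ℝ) + 1 = 4 := by rw [← hc]; norm_num
    obtain ⟨v, hv⟩ := exists_tetrahedron_vertices hr.ne' ha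
    convert isPolyhedron_convexHull (affineIndependent_of_lam (by norm_num) hv) using 1
    rw [convexHull_eq_of_lam hr.ne' (by norm_num) ha hv]
    ext p
    have hs := sum_lam r p
    simp only [Fin.sum_univ_four] at hs hc
    simp only [cell, boxBody, Set.mem_ofPred_eq, Fin.forall_fin_succ, Fin.forall_fin_zero, div_one]
    simp
    constructor
    · rintro ⟨⟨_, -⟩, ⟨_, -⟩, ⟨_, -⟩, ⟨_, -⟩⟩
      refine ⟨?_, ?_, ?_, ?_⟩ <;> linarith
    · rintro ⟨_, _, _, _⟩
      refine ⟨⟨?_, ?_⟩, ⟨?_, ?_⟩, ⟨?_, ?_⟩, ⟨?_, ?_⟩⟩ <;> linarith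

theorem isConnected_interior_cell (hr : r ≠ 0) (hf : IsCellIndex M f) :
    IsConnected (interior (cell r f)) := by
  refine ⟨?_, (convex_boxBody r _ _).interior.isPreconnected⟩
  obtain ⟨h1, h2, -⟩ := hf
  have hc : ((∑ i, (f i : ℕ) : ℕ) : ℝ) = ∑ i, ((f i : ℕ) : ℝ) := by push_cast; rfl
  have h1' : (1 : ℝ) ≤ ((∑ i, (f i : ℕ) : ℕ) : ℝ) := by exact_mod_cast h1
  have h2' : ((∑ i, (f i : ℕ) : ℕ) : ℝ) ≤ 3 := by exact_mod_cast h2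
  -- The excess over the corner is shared equally among the four coordinates.
  obtain ⟨p, hp⟩ := exists_lam_eq hr
    (fun i => ((f i : ℕ) : ℝ) + (4 - ((∑ i, (f i : ℕ) : ℕ) : ℝ)) / 4)
    (by rw [Finset.sum_add_distrib, ← hc]; simp; ring)
  refine ⟨p, (mem_interior_boxBody_iff hr).2 fun i => ?_⟩
  rw [hp]
  constructor <;> linarith

theorem disjoint_interior_cell (hr : r ≠ 0) {f f' : Fin 4 → Fin 4} (h : f ≠ f') :
    Disjoint (interior (cell r f)) (interior (cell r f')) := by
  obtain ⟨i, hi⟩ := Function.ne_iff.1 h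
  rcases lt_or_gt_of_ne hi with h | h
  · exact disjoint_interior_boxBody hr i (by exact_mod_cast Fin.lt_def.1 h)
  · exact (disjoint_interior_boxBody hr i (by exact_mod_cast Fin.lt_def.1 h)).symm

theorem cell_subset_body (hf : IsCellIndex M f) : cell r f ⊆ body r M := by
  intro p hp i
  have h1 : (((f i : ℕ) : ℝ) + 1) ≤ M := by exact_mod_cast hf.2.2 i
  exact ⟨(Nat.cast_nonneg _).trans (hp i).1, (hp i).2.trans h1⟩

/-- The facet `lam j = f j + e` of a cell consists of internal cuts, if it is not on the surface
of the body. -/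
theorem mem_internalCuts_cell (hr : r ≠ 0) (hf : IsCellIndex M f) {p : Space} (hp : p ∈ cell r f)
    {j : Fin 4} {e : ℕ} (he : e = 0 ∨ e = 1) (hj : lam r p j = (f j : ℕ) + e)
    (h1 : ∑ i, (f i : ℕ) + e ≤ 3) (h2 : 2 ≤ ∑ i, (f i : ℕ) + e)
    (h3 : 0 < (f j : ℕ) + e) (h4 : (f j : ℕ) + e < M) :
    p ∈ internalCuts (body r M) (cell r f) := by
  have hc : ((∑ i, (f i : ℕ) : ℕ) : ℝ) = ∑ i, ((f i : ℕ) : ℝ) := by push_cast; rfl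
  set S := ∑ i, (f i : ℕ) with hS
  have h1' : (S : ℝ) + e ≤ 3 := by exact_mod_cast h1
  have h2' : 2 ≤ (S : ℝ) + e := by exact_mod_cast h2
  -- The centre of the facet: the bounds on the corner sum put the remaining excess strictly between
  -- 0 and 1 in each other coordinate.
  obtain ⟨m, hm⟩ := exists_lam_eq hr
    (fun i => ((f i : ℕ) : ℝ) + if i = j then (e : ℝ) else (4 - S - e) / 3) (by
      rw [Finset.sum_add_distrib, ← hc, ← Finset.add_sum_erase _ _ (Finset.mem_univ j),
        Finset.sum_congr rfl fun i hi => if_neg (Finset.ne_of_mem_erase hi)]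
      simp
      ring)
  have hmj : lam r m j = (f j : ℕ) + e := by simp [hm]
  have he' : (0 : ℝ) ≤ e ∧ (e : ℝ) ≤ 1 := by rcases he with rfl | rfl <;> norm_num
  refine mem_internalCuts_boxBody hr (m := m) (j := j) (c := (f j : ℕ) + e) ?_ hp hj ?_ hmj
    (cell_subset_body hf hp) ((mem_interior_boxBody_iff hr).2 ?_)
  · rcases he with rfl | rfl <;> simp
  · intro i
    rw [hm]
    split_ifs <;> constructor <;> linarith
  · intro i
    by_cases h : i = j
    · subst h
      rw [hmj]
      exact ⟨by exact_mod_cast h3, by exact_mod_cast h4⟩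
    · rw [hm, if_neg h]
      have h5 : (((f i : ℕ) : ℝ) + 1) ≤ M := by exact_mod_cast hf.2.2 i
      have h6 : (0 : ℝ) ≤ (f i : ℕ) := Nat.cast_nonneg _
      constructor <;> linarith

end Cells

/-- For every cell there is a proper motion to its target, which sends inner facets to outer
ones. -/
theorem exists_cell_motion {M : ℕ} (hM : M = 2 ∨ M = 5) {r : ℝ} (hr : r ≠ 0) {f : Fin 4 → Fin 4}
    (hf : IsCellIndex M f) :
    ∃ g : Space ≃ᵃⁱ[ℝ] Space, IsProperMotion g ∧
      (∀ p, g p ∈ cell r (cellTarget M f) ↔ p ∈ cell r f) ∧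
      (∀ p ∈ cell r f, ∀ i, lam r (g p) i = 0 → 2 ≤ ∑ i, (cellTarget M f i : ℕ) →
        p ∈ internalCuts (body r M) (cell r f)) ∧
      (∀ p ∈ cell r f, ∀ i, lam r (g p) i = M → ∑ i, (cellTarget M f i : ℕ) ≤ 2 →
        p ∈ internalCuts (body r M) (cell r f)) := by
  have hM' : M ∈ ({2, 5} : Finset ℕ) := by simpa using hM
  obtain ⟨⟨t1, t2, t3⟩, -⟩ := cellTarget_spec M hM' f hf
  obtain ⟨σ, hσ⟩ := exists_cellMove M hM' f hf
  set f' := cellTarget M f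
  obtain ⟨b1, b2, b3⟩ := id hf
  have hzero : ∀ p ∈ cell r f', ∀ i, lam r p i = 0 → f' i = 0 := by
    intro p hp i hi
    have h : ((f' i : ℕ) : ℝ) ≤ lam r p i := (hp i).1
    rw [hi] at h
    have h' : (f' i : ℕ) ≤ 0 := by exact_mod_cast h
    exact Fin.ext (Nat.le_zero.1 h')
  have hmax : ∀ p ∈ cell r f', ∀ i, lam r p i = M → (f' i : ℕ) + 1 = M := by
    intro p hp i hi
    have h : lam r p i ≤ (f' i : ℕ) + 1 := (hp i).2
    rw [hi] at h
    exact le_antisymm (t3 i) (by exact_mod_cast h)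
  have hpos : ∀ i, f i ≠ 0 → 0 < (f i : ℕ) := fun i hi =>
    Nat.pos_of_ne_zero fun h => hi (Fin.ext h)
  have hM2 : 2 ≤ M := by omega
  rcases hσ with ⟨hs, hsum, hi⟩ | ⟨hs, hsum, hi⟩
  · have hsum' : ∑ i, ((f i : ℕ) : ℝ) = ∑ i, ((f' i : ℕ) : ℝ) := by exact_mod_cast hsum
    obtain ⟨g, hg, hl⟩ := exists_properMotion_lam hr σ
      (fun i => ((f' i : ℕ) : ℝ) - (f (σ i) : ℕ))
      (by rw [hs, Finset.sum_sub_distrib, ← hsum', Equiv.sum_comp σ fun i => ((f i : ℕ) : ℝ)]; simp)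
    simp only [hs, Units.val_one, Int.cast_one, one_mul] at hl
    have hcell : ∀ p, g p ∈ cell r f' ↔ p ∈ cell r f := by
      intro p
      refine (forall_congr' fun i => ?_).trans (σ.forall_congr_right
        (q := fun i => ((f i : ℕ) : ℝ) ≤ lam r p i ∧ lam r p i ≤ ((f i : ℕ) : ℝ) + 1))
      rw [hl]
      constructor <;> rintro ⟨_, _⟩ <;> constructor <;> linarith
    refine ⟨g, hg, hcell, fun p hp i h0 h2 => ?_, fun p hp i h0 h2 => ?_⟩
    · have h3 := hzero _ ((hcell p).2 hp) i h0
      refine mem_internalCuts_cell hr hf hp (j := σ i) (Or.inl rfl) ?_ (by omega) (by omega)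
        (hpos _ ((hi i).1 h2 h3)) (b3 _)
      rw [hl, h3] at h0
      simp at h0 ⊢
      linarith
    · have h3 := hmax _ ((hcell p).2 hp) i h0
      refine mem_internalCuts_cell hr hf hp (j := σ i) (Or.inr rfl) ?_ (by omega) (by omega)
        (by omega) (lt_of_le_of_ne (b3 _) ((hi i).2 h2 h3))
      rw [hl, ← h3] at h0
      push_cast at h0 ⊢
      linarith
  · have hsum' : ∑ i, ((f i : ℕ) : ℝ) + ∑ i, ((f' i : ℕ) : ℝ) = 4 := by exact_mod_cast hsum
    obtain ⟨g, hg, hl⟩ := exists_properMotion_lam hr σ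
      -- The reversed unit interval must start at `f' i`, whence the extra 1. Lower facets become
      -- upper ones and conversely.
      (fun i => ((f (σ i) : ℕ) : ℝ) + (f' i : ℕ) + 1)
      (by
        rw [hs, Finset.sum_add_distrib, Finset.sum_add_distrib,
          Equiv.sum_comp σ fun i => ((f i : ℕ) : ℝ), hsum']
        norm_num)
    simp only [hs, Units.val_neg, Units.val_one, Int.cast_neg, Int.cast_one, neg_mul, one_mul] at hl
    have hcell : ∀ p, g p ∈ cell r f' ↔ p ∈ cell r f := by
      intro p
      refine (forall_congr' fun i => ?_).trans (σ.forall_congr_right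
        (q := fun i => ((f i : ℕ) : ℝ) ≤ lam r p i ∧ lam r p i ≤ ((f i : ℕ) : ℝ) + 1))
      rw [hl]
      constructor <;> rintro ⟨_, _⟩ <;> constructor <;> linarith
    refine ⟨g, hg, hcell, fun p hp i h0 h2 => ?_, fun p hp i h0 h2 => ?_⟩
    · have h3 := hzero _ ((hcell p).2 hp) i h0
      refine mem_internalCuts_cell hr hf hp (j := σ i) (Or.inr rfl) ?_ (by omega) (by omega)
        (by omega) (lt_of_le_of_ne (b3 _) ((hi i).1 h2 h3))
      rw [hl, h3] at h0
      simp at h0 ⊢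
      linarith
    · have h3 := hmax _ ((hcell p).2 hp) i h0
      refine mem_internalCuts_cell hr hf hp (j := σ i) (Or.inl rfl) ?_ (by omega) (by omega)
        (hpos _ ((hi i).2 h2 h3)) (b3 _)
      rw [hl, ← h3] at h0
      push_cast at h0 ⊢
      linarith

theorem selfDissectable_body {M : ℕ} (hM : M = 2 ∨ M = 5) {r : ℝ} (hr : 0 < r) :
    SelfDissectable (body r M) := by
  have hM' : M ∈ ({2, 5} : Finset ℕ) := by simpa using hM
  choose g hg1 hg2 hg3 hg4 using fun f : {f // IsCellIndex M f} =>
    exists_cell_motion hM hr.ne' f.2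
  have himg : ∀ f, g f '' cell r f = cell r (cellTarget M f) := by
    intro f
    ext q
    obtain ⟨p, rfl⟩ := (g f).surjective q
    rw [hg2, (g f).injective.mem_set_image]
  have hcover : ⋃ f : {f // IsCellIndex M f}, cell r f = body r M := by
    apply Set.Subset.antisymm (Set.iUnion_subset fun f => cell_subset_body f.2)
    intro p hp
    obtain ⟨f, hf, hpf, -⟩ := exists_cell_of_mem_body hM hp
    exact Set.mem_iUnion.2 ⟨⟨f, hf⟩, hpf⟩
  let τ : {f // IsCellIndex M f} → {f // IsCellIndex M f} :=
    fun f => ⟨cellTarget M f, (cellTarget_spec M hM' f f.2).1⟩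
  have hτ : Function.Involutive τ := fun f => Subtype.ext (cellTarget_spec M hM' f f.2).2
  have hpull : ∀ q f, IsCellIndex M f → q ∈ cell r f → ∃ f', cellTarget M f'.1 = f ∧
      ∃ p ∈ cell r f'.1, g f' p = q := by
    intro q f hf hq
    have h : cellTarget M (τ ⟨f, hf⟩) = f := congrArg Subtype.val (hτ ⟨f, hf⟩)
    refine ⟨τ ⟨f, hf⟩, h, ?_⟩
    rw [← h, ← himg] at hq
    exact hq
  refine ⟨{f // IsCellIndex M f}, inferInstance, fun f => cell r f, g,
    fun f => ⟨isPolyhedron_cell hr f.2, isConnected_interior_cell hr.ne' f.2⟩,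
    ⟨hcover, fun f f' h => disjoint_interior_cell hr.ne' fun h' => h (Subtype.ext h')⟩, hg1,
    ⟨?_, fun f f' h => ?_⟩, ?_⟩
  · simp only [himg]
    rw [← hcover]
    exact hτ.surjective.iUnion_comp fun f => cell r f.1
  · simp only [himg]
    exact disjoint_interior_cell hr.ne' fun h' => h (hτ.injective (Subtype.ext h'))
  · intro q hq
    obtain ⟨hqb, i, hi | hi⟩ := (mem_frontier_boxBody_iff hr.ne').1 hq
    · obtain ⟨f, hf, hqf, h2⟩ := exists_cell_of_mem_body hM hqb
      obtain ⟨f', rfl, p, hp, rfl⟩ := hpull q f hf hqf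
      exact Set.mem_iUnion.2 ⟨f', p, hg3 f' p hp i hi (h2 ⟨i, hi⟩), rfl⟩
    · obtain ⟨f, hf, hqf, h2⟩ := exists_cell_of_upper hM hqb hi
      obtain ⟨f', rfl, p, hp, rfl⟩ := hpull q f hf hqf
      exact Set.mem_iUnion.2 ⟨f', p, hg4 f' p hp i hi h2, rfl⟩

/-! ### Transport by isometries and gluing. -/

theorem IsPolyhedron.image {P : Set Space} (hP : IsPolyhedron P) (F : Space ≃ᵃⁱ[ℝ] Space) :
    IsPolyhedron (F '' P) := by
  obtain ⟨n, v, hv, rfl⟩ := hP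
  refine ⟨n, fun i j => F (v i j), fun i => ?_, ?_⟩
  · exact (hv i).map' F.toAffineEquiv.toAffineMap F.injective
  · rw [Set.image_iUnion]
    refine Set.iUnion_congr fun i => ?_
    have := F.toAffineEquiv.toAffineMap.image_convexHull (Set.range (v i))
    rw [← Set.range_comp] at this
    exact this

theorem IsDecomposition.image {ι : Type*} {P : Set Space} {Q : ι → Set Space}
    (h : IsDecomposition P Q) (F : Space ≃ᵃⁱ[ℝ] Space) :
    IsDecomposition (F '' P) (fun i => F '' Q i) := by
  refine ⟨by rw [← h.1, Set.image_iUnion], fun i j hij => ?_⟩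
  have := h.2 hij
  have hi : ∀ s, interior (F '' s) = F '' interior s := fun s =>
    (F.toHomeomorph.image_interior s).symm
  simp only [hi]
  exact (Set.disjoint_image_iff F.injective).2 this

theorem image_internalCuts (P Q : Set Space) (F : Space ≃ᵃⁱ[ℝ] Space) :
    F '' internalCuts P Q = internalCuts (F '' P) (F '' Q) := by
  have h1 : F '' closure (frontier Q ∩ interior P) = closure (F '' (frontier Q ∩ interior P)) :=
    F.toHomeomorph.image_closure _
  have h2 : F '' frontier Q = frontier (F '' Q) := F.toHomeomorph.image_frontier _
  have h3 : F '' interior P = interior (F '' P) := F.toHomeomorph.image_interior _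
  rw [internalCuts, h1, Set.image_inter F.injective, h2, h3, internalCuts]

/-- Conjugation preserves the determinant, so `F` may reverse orientation; left-handed frames do no
harm. -/
theorem IsProperMotion.conj {g : Space ≃ᵃⁱ[ℝ] Space} (hg : IsProperMotion g)
    (F : Space ≃ᵃⁱ[ℝ] Space) : IsProperMotion ((F.symm.trans g).trans F) := by
  rw [IsProperMotion] at hg ⊢
  rw [← hg, ← LinearMap.det_conj (g.linearIsometryEquiv.toLinearEquiv : Space →ₗ[ℝ] Space)
    F.linearIsometryEquiv.toLinearEquiv]
  rfl

theorem SelfDissectable.image {B : Set Space} (h : SelfDissectable B) (F : Space ≃ᵃⁱ[ℝ] Space) :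
    SelfDissectable (F '' B) := by
  obtain ⟨ι, hι, Q, g, h1, h2, h3, h4, h5⟩ := h
  have hconj : ∀ i s, ((F.symm.trans (g i)).trans F) '' (F '' s) = F '' (g i '' s) := by
    intro i s
    simp only [Set.image_image]
    refine Set.image_congr fun x _ => ?_
    simp
  refine ⟨ι, hι, fun i => F '' Q i, fun i => (F.symm.trans (g i)).trans F,
    fun i => ⟨(h1 i).1.image F, ?_⟩, h2.image F, fun i => (h3 i).conj F, ?_, ?_⟩
  · have hi : interior (F '' Q i) = F '' interior (Q i) :=
      (F.toHomeomorph.image_interior _).symm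
    rw [hi]
    exact (h1 i).2.image F F.continuous.continuousOn
  · simp only [hconj]
    exact h4.image F
  · have hf : frontier (F '' B) = F '' frontier B := (F.toHomeomorph.image_frontier _).symm
    rw [hf]
    refine (Set.image_mono h5).trans ?_
    rw [Set.image_iUnion]
    simp only [← image_internalCuts, hconj]
    exact subset_rfl

theorem IsDecomposition.sigma {ι : Type*} {κ : ι → Type*} {P : Set Space} {D : ι → Set Space}
    (h : IsDecomposition P D) {Q : ∀ i, κ i → Set Space} (hQ : ∀ i, IsDecomposition (D i) (Q i)) :
    IsDecomposition P (fun x : Σ i, κ i => Q x.1 x.2) := by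
  refine ⟨?_, ?_⟩
  · rw [Set.iUnion_sigma, ← h.1]
    exact Set.iUnion_congr fun i => (hQ i).1
  · rintro ⟨i, a⟩ ⟨j, b⟩ hne
    by_cases hij : i = j
    · subst hij
      exact (hQ i).2 fun hab => hne (congrArg _ hab)
    · refine (h.2 hij).mono (interior_mono ?_) (interior_mono ?_)
      · rw [← (hQ i).1]; exact Set.subset_iUnion (Q i) a
      · rw [← (hQ j).1]; exact Set.subset_iUnion (Q j) b

theorem IsDecomposition.comp_equiv {ι κ : Type*} {P : Set Space} {Q : ι → Set Space}
    (h : IsDecomposition P Q) (e : κ ≃ ι) : IsDecomposition P (fun k => Q (e k)) :=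
  ⟨by rw [← h.1]; exact e.surjective.iUnion_comp Q, fun _ _ hij => h.2 (e.injective.ne hij)⟩

theorem frontier_iUnion_subset_of_finite {X ι : Type*} [TopologicalSpace X] [Finite ι]
    (D : ι → Set X) : frontier (⋃ i, D i) ⊆ ⋃ i, frontier (D i) := by
  intro x hx
  have h1 : x ∈ ⋃ i, closure (D i) := by
    rw [← closure_iUnion_of_finite]
    exact hx.1
  obtain ⟨i, hi⟩ := Set.mem_iUnion.1 h1
  exact Set.mem_iUnion.2 ⟨i, hi, fun h => hx.2 (interior_mono (Set.subset_iUnion D i) h)⟩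

theorem SelfDissectable.of_isDecomposition {ι : Type} [Finite ι] {P : Set Space}
    {D : ι → Set Space} (hD : IsDecomposition P D) (h : ∀ i, SelfDissectable (D i)) :
    SelfDissectable P := by
  choose κ hκ Q g h1 h2 h3 h4 h5 using h
  refine ⟨Σ i, κ i, inferInstance, fun x => Q x.1 x.2, fun x => g x.1 x.2, fun x => h1 x.1 x.2,
    hD.sigma h2, fun x => h3 x.1 x.2, hD.sigma h4, ?_⟩
  rw [Set.iUnion_sigma]
  have hP : frontier P ⊆ ⋃ i, frontier (D i) := hD.1 ▸ frontier_iUnion_subset_of_finite D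
  refine hP.trans (Set.iUnion_mono fun i => (h5 i).trans (Set.iUnion_mono fun a => ?_))
  refine Set.image_mono (closure_mono (Set.inter_subset_inter_right _ (interior_mono ?_)))
  rw [← hD.1]
  exact Set.subset_iUnion D i

theorem SelfDissectable.insideOutDissectable {P : Set Space} (h : SelfDissectable P) :
    InsideOutDissectable P := by
  obtain ⟨ι, hι, Q, g, h1, h2, h3, h4, h5⟩ := h
  obtain ⟨k, ⟨e⟩⟩ := Finite.exists_equiv_fin ι
  refine ⟨k, fun i => Q (e.symm i), fun i => g (e.symm i), P, fun i => h1 _,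
    h2.comp_equiv e.symm, fun i => h3 _, h4.comp_equiv e.symm,
    ⟨AffineIsometryEquiv.refl ℝ Space, by simp⟩, h5.trans ?_⟩
  exact (e.symm.surjective.iUnion_comp fun i => g i '' internalCuts P (Q i)).ge

/-! ### Regular solids in arbitrary position. -/

/-- The isometry that takes the standard frame to the frame with origin `c` and axes `b`. -/
noncomputable def frameMap (c : Space) (b : OrthonormalBasis (Fin 3) ℝ Space) :
    Space ≃ᵃⁱ[ℝ] Space :=
  b.repr.symm.toAffineIsometryEquiv.trans (AffineIsometryEquiv.constVAdd ℝ Space c)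

theorem frameMap_apply (c : Space) (b : OrthonormalBasis (Fin 3) ℝ Space) (x : Space) :
    frameMap c b x = c + ∑ k, x k • b k := by
  rw [b.sum_repr_symm]
  rfl

theorem IsRegularOctahedron.selfDissectable {O : Set Space} (h : IsRegularOctahedron O) :
    SelfDissectable O := by
  obtain ⟨c, r, b, hr, rfl⟩ := h
  have hbody : body r 2 = octa 0 r := by
    have := octa_eq_lam hr 0 1
    rw [mul_one] at this
    rw [this]
    ext p
    refine forall_congr' fun i => ?_
    have h0 : lam r 0 i = 1 := by simp [lam]
    rw [h0, abs_le]
    push_cast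
    refine and_congr ⟨fun h => ?_, fun h => ?_⟩ ⟨fun h => ?_, fun h => ?_⟩ <;> linarith
  have h2 := (selfDissectable_body (Or.inl rfl) hr).image (frameMap c b)
  rw [hbody, octa_eq_convexHull 0 hr] at h2
  have h3 := (frameMap c b).toAffineEquiv.toAffineMap.image_convexHull
    (Set.range (fun i : Fin 3 => 0 + r • (EuclideanSpace.single i 1 : Space)) ∪
        Set.range (fun i : Fin 3 => 0 - r • (EuclideanSpace.single i 1 : Space)))
  have h4 : ⇑(frameMap c b).toAffineEquiv.toAffineMap = frameMap c b := rfl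
  rw [h4] at h3
  rw [h3, Set.image_union, ← Set.range_comp, ← Set.range_comp] at h2
  convert h2 using 6
  · ext1 i
    simp [frameMap_apply, PiLp.single_apply]
  · ext1 i
    simp [frameMap_apply, PiLp.single_apply, sub_eq_add_neg]

/-- The axes of the cube around a regular tetrahedron, in terms of the three edges at a vertex. -/
theorem exists_orthonormalBasis_of_edges {x y z : Space} {r : ℝ} (hr : 0 < r)
    (hxx : inner ℝ x x = 8 * r ^ 2) (hyy : inner ℝ y y = 8 * r ^ 2)
    (hzz : inner ℝ z z = 8 * r ^ 2) (hxy : inner ℝ x y = 4 * r ^ 2)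
    (hxz : inner ℝ x z = 4 * r ^ 2) (hyz : inner ℝ y z = 4 * r ^ 2) :
    ∃ b : OrthonormalBasis (Fin 3) ℝ Space, x = -(2 * r) • (b 1 + b 2) ∧
      y = -(2 * r) • (b 0 + b 2) ∧ z = -(2 * r) • (b 0 + b 1) := by
  have hyx := (real_inner_comm x y).trans hxy
  have hzx := (real_inner_comm x z).trans hxz
  have hzy := (real_inner_comm y z).trans hyz
  -- The edges are face diagonals of a cube of side `2 * r`; these combinations are `4 * r` times
  -- its axes.
  obtain ⟨u, h0, h1, h2⟩ : ∃ u : Fin 3 → Space, u 0 = x - y - z ∧ u 1 = y - x - z ∧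
      u 2 = z - x - y := ⟨![x - y - z, y - x - z, z - x - y], rfl, rfl, rfl⟩
  have hu : ∀ i j, inner ℝ (u i) (u j) = if i = j then 16 * r ^ 2 else 0 := by
    simp only [Fin.forall_fin_succ, Fin.forall_fin_zero, Fin.succ_zero_eq_one, Fin.succ_one_eq_two,
      h0, h1, h2, inner_sub_left, inner_sub_right, hxx, hyy, hzz, hxy, hxz, hyz, hyx, hzx, hzy]
    simp
    and_intros <;> ring
  have he : Orthonormal ℝ fun i => (4 * r)⁻¹ • u i := by
    rw [orthonormal_iff_ite]
    intro i j
    rw [inner_smul_left, inner_smul_right, hu]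
    split_ifs
    · simp
      field_simp
      norm_num
    · simp
  obtain ⟨b, hb⟩ := Orthonormal.exists_orthonormalBasis_extension_of_card_eq (𝕜 := ℝ) (E := Space)
    (ι := Fin 3) (by simp) (s := Set.univ) (v := fun i => (4 * r)⁻¹ • u i)
    (he.comp (fun i : (Set.univ : Set (Fin 3)) => i.1) Subtype.val_injective)
  have hb' : ∀ i, (2 * r) • b i = (1 / 2 : ℝ) • u i := by
    intro i
    rw [hb i (Set.mem_univ i), smul_smul]
    congr 1
    field_simp
    norm_num
  refine ⟨b, ?_, ?_, ?_⟩ <;> rw [neg_smul, smul_add] <;> simp only [hb', h0, h1, h2] <;> module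

/-- The vertices of a regular tetrahedron are alternate vertices of a cube. -/
theorem exists_frame_of_regularTetrahedron {v : Fin 4 → Space} {a : ℝ} (ha : 0 < a)
    (hv : ∀ i j, i ≠ j → dist (v i) (v j) = a) :
    ∃ (c : Space) (r : ℝ) (b : OrthonormalBasis (Fin 3) ℝ Space), 0 < r ∧
      ∀ i, v i = c + r • ∑ k, (faceNormal i k : ℝ) • b k := by
  obtain ⟨r, hr, hr2⟩ : ∃ r : ℝ, 0 < r ∧ a ^ 2 = 8 * r ^ 2 := by
    refine ⟨a / √8, by positivity, ?_⟩
    rw [div_pow, Real.sq_sqrt (by norm_num)]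
    ring
  have h8 : ∀ i, i ≠ 0 → inner ℝ (v i - v 0) (v i - v 0) = 8 * r ^ 2 := fun i hi => by
    rw [real_inner_self_eq_norm_sq, ← dist_eq_norm, hv i 0 hi, hr2]
  have h4 : ∀ i j, i ≠ 0 → j ≠ 0 → i ≠ j → inner ℝ (v i - v 0) (v j - v 0) = 4 * r ^ 2 := by
    intro i j hi hj hij
    rw [real_inner_eq_norm_mul_self_add_norm_mul_self_sub_norm_sub_mul_self_div_two,
      sub_sub_sub_cancel_right, ← dist_eq_norm, ← dist_eq_norm, ← dist_eq_norm, hv i 0 hi,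
      hv j 0 hj, hv i j hij]
    linarith
  obtain ⟨b, h1, h2, h3⟩ := exists_orthonormalBasis_of_edges hr (h8 1 (by decide))
    (h8 2 (by decide)) (h8 3 (by decide)) (h4 1 2 (by decide) (by decide) (by decide))
    (h4 1 3 (by decide) (by decide) (by decide)) (h4 2 3 (by decide) (by decide) (by decide))
  rw [sub_eq_iff_eq_add] at h1 h2 h3
  refine ⟨v 0 - r • (b 0 + b 1 + b 2), r, b, hr, ?_⟩
  simp only [Fin.forall_fin_succ, Fin.forall_fin_zero, Fin.succ_zero_eq_one, Fin.succ_one_eq_two,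
    Fin.sum_univ_three, faceNormal]
  refine ⟨?_, ?_, ?_, ?_, trivial⟩
  · simp
  · rw [h1]; simp; module
  · rw [h2]; simp; module
  · change v 3 = _
    rw [h3]; simp; module

theorem IsRegularTetrahedron.selfDissectable {T : Set Space} (h : IsRegularTetrahedron T) :
    SelfDissectable T := by
  obtain ⟨v, a, ha, hv, rfl⟩ := h
  obtain ⟨c, r, b, hr, hvc⟩ := exists_frame_of_regularTetrahedron ha hv
  let w : Fin 4 → Space := fun i => WithLp.toLp 2 fun k => r * faceNormal i k
  have hw : ∀ i j, lam r (w i) j = (fun _ => (0 : ℝ)) j + if i = j then 4 else 0 := by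
    intro i j
    have : ∀ i j, ∑ k, faceNormal j k * faceNormal i k = (if i = j then 4 else 0) - 1 := by decide
    have h' : ∑ k, (faceNormal j k : ℝ) * (faceNormal i k : ℝ) = (if i = j then 4 else 0) - 1 := by
      exact_mod_cast congrArg (Int.cast : ℤ → ℝ) (this i j)
    simp only [lam, w, mul_left_comm _ r, ← Finset.mul_sum, h']
    field_simp
    ring
  -- Nonnegative coordinates of sum 4 are at most 4, so the upper bound 5 is never active.
  have hbody : body r 5 = convexHull ℝ (Set.range w) := by
    rw [convexHull_eq_of_lam hr.ne' (by norm_num) (by simp) hw]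
    ext p
    have hs := sum_lam r p
    rw [Fin.sum_univ_four] at hs
    simp only [body, boxBody, Set.mem_ofPred_eq, Fin.forall_fin_succ, Fin.forall_fin_zero]
    simp
    constructor
    · rintro ⟨⟨_, -⟩, ⟨_, -⟩, ⟨_, -⟩, ⟨_, -⟩⟩
      refine ⟨?_, ?_, ?_, ?_⟩ <;> linarith
    · rintro ⟨_, _, _, _⟩
      refine ⟨⟨?_, ?_⟩, ⟨?_, ?_⟩, ⟨?_, ?_⟩, ⟨?_, ?_⟩⟩ <;> linarith
  have h2 := (selfDissectable_body (Or.inr rfl) hr).image (frameMap c b)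
  have h3 := (frameMap c b).toAffineEquiv.toAffineMap.image_convexHull (Set.range w)
  have h4 : ⇑(frameMap c b).toAffineEquiv.toAffineMap = frameMap c b := rfl
  rw [h4] at h3
  rw [hbody, h3, ← Set.range_comp] at h2
  convert h2 using 3
  ext1 i
  simp [hvc, frameMap_apply, w, Finset.smul_sum, smul_smul]

theorem mainTheorem3 (P : Set Space) (hP : IsPolyhedron P)
    (hdec : ∃ (m : ℕ) (D : Fin m → Set Space),
      (∀ j, IsRegularTetrahedron (D j) ∨ IsRegularOctahedron (D j)) ∧ IsDecomposition P D) :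
    InsideOutDissectable P := by
  obtain ⟨m, D, hD, hPD⟩ := hdec
  exact (SelfDissectable.of_isDecomposition hPD fun j =>
    (hD j).elim (·.selfDissectable) (·.selfDissectable)).insideOutDissectable
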